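/- A tropical polynomial in $n$ variables with (nonempty, finite) support $\mathcal W\subset\mathbb R^n$ is a function $f(x)=\max_{w\in\mathcal W}(a_w+\langle w,x\rangle)$ with real coefficients $a_w$, $w\in\mathcal W$. Its tropical hypersurface is the set of points $x\in\mathbb R^n$ at which the maximum is attained for at least two $w\in\mathcal W$. For $p\in\mathbb R^n$, the linear piece of $f$ containing $p$ in its relative interior is the closed polyhedron of all $x$ such that every $w$ attaining the maximum at $p$ attains the maximum at $x$. A nondegenerate solution of a system of tropical polynomial equations $f_1,\dots,f_n$ in $n$ variables is a point $p$ common to the $n$ tropical hypersurfaces at which they intersect transversely: if $\xi_i$ is the linear piece of $f_i$ containing $p$ in its relative interior, then $\sum_{i=1}^n\operatorname{codim}\xi_i=\operatorname{codim}\bigcap_{i=1}^n\xi_i$. Theorem. Let $n\ge 0$. (1) For any nonempty finite sets $\mathcal W_1,\dots,\mathcal W_n\subset\mathbb R^n$, every system of tropical polynomial equations with supports $\mathcal W_1,\dots,\mathcal W_n$ has at most $\prod_{i=1}^n(|\mathcal W_i|-1)$ nondegenerate solutions. (2) This bound is sharp: for all integers $k_1,\dots,k_n\ge 1$ there is a nonempty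 open set $U$ of configurations $c=(c_{i,j})_{1\le i\le n,\,1\le j\le k_i}$ of points of $\mathbb R^n$ such that for every $c\in U$ the sets $\mathcal W_i=\{c_{i,1},\dots,c_{i,k_i}\}$ satisfy $|\mathcal W_i|=k_i$, the map $\mathcal W_1\times\cdots\times\mathcal W_n\to\mathbb R^n$, $(w_1,\dots,w_n)\mapsto w_1+\cdots+w_n$, is injective, and some system of tropical polynomial equations with supports $\mathcal W_1,\dots,\mathcal W_n$ has exactly $\prod_{i=1}^n(k_i-1)$ nondegenerate solutions. (In particular, for any given cardinalities the bound is attained by supports in general position.) -/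

import Mathlib

/-- A tropical polynomial in `n` variables with real exponents: a nonempty finite support
`W ⊂ ℝⁿ` together with a real coefficient `a_w` for every exponent `w ∈ W`. -/
structure TropicalPolynomial (n : ℕ) where
  /-- the set of exponents -/
  support : Finset (Fin n → ℝ)
  support_nonempty : support.Nonempty
  /-- the coefficients -/
  coeff : support → ℝ

namespace TropicalPolynomial

variable {n : ℕ}

/-- The tropical monomial `a_w x^w`, i.e. the affine-linear function `x ↦ a_w + ⟨w, x⟩`. -/
noncomputable def monomial (f : TropicalPolynomial n) (w : f.support) (x : Fin n → ℝ) : ℝ :=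
  f.coeff w + (w : Fin n → ℝ) ⬝ᵥ x

/-- The function defined by a tropical polynomial: `f(x) = max_{w ∈ W} (a_w + ⟨w, x⟩)`. -/
noncomputable def eval (f : TropicalPolynomial n) (x : Fin n → ℝ) : ℝ :=
  f.support.attach.sup' f.support_nonempty.attach (fun w => f.monomial w x)

/-- The set of exponents whose monomials attain the maximum at `x`. -/
def activeSet (f : TropicalPolynomial n) (x : Fin n → ℝ) : Set f.support :=
  {w | f.monomial w x = f.eval x}

/-- The tropical hypersurface of `f`: the corner locus of the piecewise linear function `f`,
i.e. the points at which the maximum is attained by at least two monomials (these have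
different slopes, as the exponents are different). -/
def hypersurface (f : TropicalPolynomial n) : Set (Fin n → ℝ) :=
  {x | (f.activeSet x).Nontrivial}

/-- The (closed) linear piece, in the polyhedral subdivision of `ℝⁿ` induced by `f`, that
contains `p` in its relative interior: the points at which every monomial attaining the maximum
at `p` attains the maximum. (Its relative interior is the set of the points `x` with
`f.activeSet x = f.activeSet p`.) -/
def piece (f : TropicalPolynomial n) (p : Fin n → ℝ) : Set (Fin n → ℝ) :=
  {x | f.activeSet p ⊆ f.activeSet x}

end TropicalPolynomial

/-- The codimension in `ℝⁿ` of (the affine span of) a nonempty set. The subtraction is not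
truncated, since the dimension is at most `n`. -/
noncomputable def affineCodim {n : ℕ} (S : Set (Fin n → ℝ)) : ℕ :=
  n - Module.finrank ℝ (vectorSpan ℝ S)

/-- The nondegenerate solutions of a system of tropical polynomial equations `f i`: the points
that are common to all the tropical hypersurfaces and at which these intersect transversely,
i.e. the codimensions of the linear pieces containing the point in their relative interior
sum up to the codimension of the common intersection of these pieces. -/
def nondegenerateSolutions {n r : ℕ} (f : Fin r → TropicalPolynomial n) :
    Set (Fin n → ℝ) :=
  {p | (∀ i, p ∈ (f i).hypersurface) ∧
    ∑ i, affineCodim ((f i).piece p) = affineCodim (⋂ i, (f i).piece p)}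

/-! Upper bound: at a nondegenerate solution `p`, choose two active exponents of each equation.
Transversality forces every piece through `p` to be a hyperplane piece, so the `n` exponent
differences form a basis (`eq_zero_of_mem_nondegenerateSolutions`). Fix a linear functional `φ` that
vanishes on no vector of the dual bases at the finitely many solutions considered, and order each
pair as `(a p i, b p i)` so that `p` is the strict maximum of `φ` on the cone where every `a p
i`-monomial is at least the `b p i`-monomial. Any other solution `q` at which all `a p i` are active
lies in this cone, so `φ q < φ p`.

Attach to `p` the tensor `⊗ᵢ (δ_{a p i} - δ_{b p i})`. The value at `a p` of the tensor of `q` is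
nonzero only if all `a p i` are active at `q`, so the tensors are triangular with respect to `φ`,
hence independent. They lie in a product of zero-sum function spaces, of dimension `∏ (|Wᵢ| - 1)`.

Sharpness: `max_j (-j² + j xᵢ)` breaks at `xᵢ = 1, 3, 5, …`, so the solutions form a full grid of
transverse points. Each of them survives small changes of the exponents, and the upper bound
excludes further ones. -/

/-! ### Linear algebra: triangular tensors and dual bases. -/

/-- A vector-valued triangularity argument: pairs of distinct points `a p i`, `b p i` give the
tensor products of the differences `δ (a p i) - δ (b p i)`, which are linearly independent
elements of a space of dimension `∏ i, (card (W i) - 1)`. -/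
theorem card_le_prod_card_sub_one {ι P : Type*} [Fintype ι] [Fintype P] {W : ι → Type*}
    [∀ i, Fintype (W i)] (a b : P → ∀ i, W i) (hab : ∀ p i, a p i ≠ b p i) (φ : P → ℝ)
    (h : ∀ p q, (∀ i, a p i = a q i ∨ a p i = b q i) → q = p ∨ φ q < φ p) :
    Fintype.card P ≤ ∏ i, (Fintype.card (W i) - 1) := by
  classical
  rcases isEmpty_or_nonempty P with hP | ⟨⟨p₀⟩⟩
  · simp
  let o : ∀ i, W i := a p₀
  let g : P → ∀ i, W i → ℝ := fun p i t =>
    (if t = a p i then 1 else 0) - (if t = b p i then 1 else 0)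
  let e : P → (∀ i, W i) → ℝ := fun p t => ∏ i, g p i (t i)
  let k : ∀ i, W i → W i → ℝ := fun i s t =>
    (if t = s then 1 else 0) - (if t = o i then 1 else 0)
  let H : (∀ i, {x : W i // x ≠ o i}) → (∀ i, W i) → ℝ := fun s t => ∏ i, k i (s i) (t i)
  -- `g p i` has zero sum, so it expands in the functions `δ_s - δ_o` with `s ≠ o`; there are `card
  -- (W i) - 1` of these.
  have hg : ∀ p i t, g p i t = ∑ s : {x : W i // x ≠ o i}, g p i s * k i s t := by
    intro p i t
    have h0 : ∑ s, g p i s = 0 := by simp [g]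
    have h1 : ∑ s, g p i s * k i s t = g p i t := by
      simp only [k, mul_sub, Finset.sum_sub_distrib, ← Finset.sum_mul, h0]
      simp
    rw [← h1, Fintype.sum_eq_add_sum_subtype_ne _ (o i)]
    simp [k]
  have he : ∀ p, e p = ∑ s, (∏ i, g p i (s i)) • H s := by
    intro p
    ext t
    simp only [e, H, Finset.sum_apply, Pi.smul_apply, smul_eq_mul, ← Finset.prod_mul_distrib]
    rw [Finset.prod_congr rfl fun i _ => hg p i (t i), Finset.prod_univ_sum]
    rw [Fintype.piFinset_univ]
  have hli : LinearIndependent ℝ e := by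
    rw [Fintype.linearIndependent_iff]
    intro c hc
    by_contra! hne
    -- Among the terms of a linear relation take one with `φ` minimal: evaluated at `a p`, all the
    -- other terms vanish.
    obtain ⟨p, hp, hmin⟩ := Finset.exists_min_image (Finset.univ.filter fun p => c p ≠ 0) φ
      (by obtain ⟨i, hi⟩ := hne; exact ⟨i, by simpa using hi⟩)
    have hp' : c p ≠ 0 := by simpa using hp
    have h1 := congrFun hc (a p)
    simp only [Finset.sum_apply, Pi.smul_apply, smul_eq_mul, Pi.zero_apply] at h1
    rw [Finset.sum_eq_single p] at h1
    · have : e p (a p) = 1 := by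
        simp only [e, g]
        exact Finset.prod_eq_one fun i _ => by simp [hab p i]
      rw [this, mul_one] at h1
      exact hp' h1
    · intro q _ hqp
      by_cases hcq : c q = 0
      · simp [hcq]
      have hq := hmin q (by simpa using hcq)
      have : ∃ i, ¬ (a p i = a q i ∨ a p i = b q i) := by
        by_contra! hh
        rcases h p q hh with h2 | h2
        · exact hqp h2
        · exact absurd h2 (not_lt.2 hq)
      obtain ⟨i, hi⟩ := this
      push Not at hi
      have : e q (a p) = 0 := Finset.prod_eq_zero (Finset.mem_univ i) (by simp [g, hi.1, hi.2])
      simp [this]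
    · simp
  have hle := linearIndependent_le_span_aux' e hli (Set.range H) (by
    rintro _ ⟨p, rfl⟩
    rw [he p]
    exact Submodule.sum_mem _ fun s _ =>
      Submodule.smul_mem _ _ (Submodule.subset_span (Set.mem_range_self s)))
  refine hle.trans ((Fintype.card_range_le H).trans ?_)
  simp [Fintype.card_subtype_compl]

/-- Vectors that are separated by the functionals `⟨d i, ·⟩` have a dual basis. -/
theorem exists_dual_basis {n : ℕ} (d : Fin n → Fin n → ℝ)
    (hd : ∀ v, (∀ i, d i ⬝ᵥ v = 0) → v = 0) :
    ∃ g : Fin n → Fin n → ℝ, (∀ i, g i ≠ 0) ∧ ∀ x, x = ∑ i, (d i ⬝ᵥ x) • g i := by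
  have hdet : (Matrix.of d).det ≠ 0 := by
    intro h0
    obtain ⟨v, hv, h⟩ := Matrix.exists_mulVec_eq_zero_iff.2 h0
    exact hv (hd v fun i => congrFun h i)
  have hu : IsUnit (Matrix.of d).det := hdet.isUnit
  refine ⟨fun i => ((Matrix.of d)⁻¹).col i, fun i h0 => ?_, fun x => ?_⟩
  · have h1 := congrFun (congrFun (Matrix.mul_nonsing_inv _ hu) i) i
    rw [Matrix.mul_apply, Matrix.one_apply_eq] at h1
    have h2 : ∀ j, (Matrix.of d)⁻¹ j i = 0 := fun j => congrFun h0 j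
    simp [h2] at h1
  · have h1 : (Matrix.of d)⁻¹.mulVec ((Matrix.of d).mulVec x) = x := by
      rw [Matrix.mulVec_mulVec, Matrix.nonsing_inv_mul _ hu, Matrix.one_mulVec]
    conv_lhs => rw [← h1]
    ext j
    simp only [Matrix.mulVec, dotProduct, Finset.sum_apply, Pi.smul_apply, smul_eq_mul,
      Matrix.col_apply]
    exact Finset.sum_congr rfl fun i _ => mul_comm _ _

/-! ### Linear pieces and their direction spaces. -/

namespace TropicalPolynomial

variable {n : ℕ} (f : TropicalPolynomial n)

theorem monomial_le_eval (w : f.support) (x : Fin n → ℝ) : f.monomial w x ≤ f.eval x :=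
  Finset.le_sup' (fun w => f.monomial w x) (Finset.mem_attach _ w)

theorem mem_activeSet_iff {w : f.support} {x : Fin n → ℝ} :
    w ∈ f.activeSet x ↔ ∀ w', f.monomial w' x ≤ f.monomial w x := by
  constructor
  · intro h w'
    rw [show f.monomial w x = f.eval x from h]
    exact f.monomial_le_eval w' x
  · intro h
    exact le_antisymm (f.monomial_le_eval w x) (Finset.sup'_le _ _ fun w' _ => h w')

theorem mem_piece_self (p : Fin n → ℝ) : p ∈ f.piece p := Set.Subset.rfl

theorem monomial_sub_monomial (w : f.support) (x y : Fin n → ℝ) :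
    f.monomial w x - f.monomial w y = (w : Fin n → ℝ) ⬝ᵥ (x - y) := by
  simp [monomial, dotProduct_sub]

/-- The linear piece through `p` contains a neighbourhood of `p` in its affine span. -/
theorem eventually_add_smul_mem_piece {p v : Fin n → ℝ}
    (hv : ∀ w ∈ f.activeSet p, ∀ w' ∈ f.activeSet p,
      ((w : Fin n → ℝ) - (w' : Fin n → ℝ)) ⬝ᵥ v = 0) :
    ∀ᶠ ε : ℝ in nhds 0, p + ε • v ∈ f.piece p := by
  have hmon : ∀ (w : f.support) (ε : ℝ),
      f.monomial w (p + ε • v) = f.monomial w p + ε * ((w : Fin n → ℝ) ⬝ᵥ v) := by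
    intro w ε
    simp [monomial, dotProduct_add, add_assoc]
  have key : ∀ w ∈ f.activeSet p, ∀ w' : f.support,
      ∀ᶠ ε : ℝ in nhds 0, f.monomial w' (p + ε • v) ≤ f.monomial w (p + ε • v) := by
    intro w hw w'
    by_cases hw' : w' ∈ f.activeSet p
    · refine Filter.Eventually.of_forall fun ε => ?_
      have h1 := hv w hw w' hw'
      rw [sub_dotProduct, sub_eq_zero] at h1
      rw [hmon, hmon, h1, show f.monomial w p = f.eval p from hw,
        show f.monomial w' p = f.eval p from hw']
    · have hlt : f.monomial w' p < f.monomial w p := by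
        rw [show f.monomial w p = f.eval p from hw]
        exact lt_of_le_of_ne (f.monomial_le_eval w' p) hw'
      have hc : ∀ w : f.support, Continuous fun ε : ℝ => f.monomial w (p + ε • v) := by
        intro w
        simp only [hmon]
        fun_prop
      have := (hc w').continuousAt.eventually_lt (hc w).continuousAt
        (x₀ := 0) (by simpa using hlt)
      exact this.mono fun ε h => h.le
  have : ∀ᶠ ε : ℝ in nhds 0, ∀ w w' : f.support, w ∈ f.activeSet p →
      f.monomial w' (p + ε • v) ≤ f.monomial w (p + ε • v) := by
    rw [Filter.eventually_all]
    intro w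
    rw [Filter.eventually_all]
    intro w'
    by_cases hw : w ∈ f.activeSet p
    · exact (key w hw w').mono fun _ h _ => h
    · exact Filter.Eventually.of_forall fun _ h => absurd h hw
  exact this.mono fun ε h w hw => f.mem_activeSet_iff.2 fun w' => h w w' hw

/-- The directions of a linear piece are orthogonal to the differences of the exponents that are
active on it. -/
theorem sub_dotProduct_eq_zero_of_mem_vectorSpan {p v : Fin n → ℝ}
    (hv : v ∈ vectorSpan ℝ (f.piece p)) {w w' : f.support}
    (hw : w ∈ f.activeSet p) (hw' : w' ∈ f.activeSet p) :
    ((w : Fin n → ℝ) - (w' : Fin n → ℝ)) ⬝ᵥ v = 0 := by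
  let l : (Fin n → ℝ) →ₗ[ℝ] ℝ := dotProductBilin ℝ ℝ ((w : Fin n → ℝ) - (w' : Fin n → ℝ))
  have hle : vectorSpan ℝ (f.piece p) ≤ LinearMap.ker l := by
    rw [vectorSpan_def, Submodule.span_le]
    rintro _ ⟨x, hx, y, hy, rfl⟩
    have hx1 : f.monomial w x = f.eval x := hx hw
    have hx2 : f.monomial w' x = f.eval x := hx hw'
    have hy1 : f.monomial w y = f.eval y := hy hw
    have hy2 : f.monomial w' y = f.eval y := hy hw'
    have h1 := f.monomial_sub_monomial w x y
    have h2 := f.monomial_sub_monomial w' x y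
    show ((w : Fin n → ℝ) - (w' : Fin n → ℝ)) ⬝ᵥ (x - y) = 0
    rw [sub_dotProduct]
    linarith
  exact hle hv

/-- The directions orthogonal to all differences of active exponents belong to the direction
space of any intersection of linear pieces. -/
theorem mem_vectorSpan_iInter_piece {ι : Type*} [Finite ι] (F : ι → TropicalPolynomial n)
    {p v : Fin n → ℝ}
    (hv : ∀ i, ∀ w ∈ (F i).activeSet p, ∀ w' ∈ (F i).activeSet p,
      ((w : Fin n → ℝ) - (w' : Fin n → ℝ)) ⬝ᵥ v = 0) :
    v ∈ vectorSpan ℝ (⋂ i, (F i).piece p) := by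
  have h1 : ∀ᶠ ε : ℝ in nhds 0, ∀ i, p + ε • v ∈ (F i).piece p :=
    Filter.eventually_all.2 fun i => (F i).eventually_add_smul_mem_piece (hv i)
  -- A single nonzero `ε` suffices: `ε • v` is then a difference of two points of the intersection.
  obtain ⟨ε, hε, hne⟩ := ((h1.filter_mono nhdsWithin_le_nhds).and
    (self_mem_nhdsWithin (a := (0 : ℝ)) (s := {0}ᶜ))).exists
  have h2 : (p + ε • v) -ᵥ p ∈ vectorSpan ℝ (⋂ i, (F i).piece p) :=
    vsub_mem_vectorSpan ℝ (Set.mem_iInter.2 hε)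
      (Set.mem_iInter.2 fun i => (F i).mem_piece_self p)
  rw [vsub_eq_sub, add_sub_cancel_left] at h2
  exact (Submodule.smul_mem_iff _ hne).1 h2

theorem mem_vectorSpan_piece {p v : Fin n → ℝ}
    (hv : ∀ w ∈ f.activeSet p, ∀ w' ∈ f.activeSet p,
      ((w : Fin n → ℝ) - (w' : Fin n → ℝ)) ⬝ᵥ v = 0) :
    v ∈ vectorSpan ℝ (f.piece p) := by
  rw [← Set.iInter_const (ι := Unit) (f.piece p)]
  exact mem_vectorSpan_iInter_piece (fun _ : Unit => f) fun _ => hv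

end TropicalPolynomial

/-- The hyperplane orthogonal to a nonzero vector. -/
theorem finrank_ker_dotProduct {n : ℕ} {d : Fin n → ℝ} (hd : d ≠ 0) :
    Module.finrank ℝ (LinearMap.ker (dotProductBilin ℝ ℝ d)) + 1 = n := by
  have hne : (dotProductBilin ℝ ℝ d : Module.Dual ℝ (Fin n → ℝ)) ≠ 0 := by
    intro h0
    refine hd (dotProduct_self_eq_zero.1 ?_)
    exact LinearMap.congr_fun h0 d
  simpa using Module.Dual.finrank_ker_add_one_of_ne_zero hne

/-! ### Transversality and the upper bound. -/

section NondegenerateSolutions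

variable {n : ℕ} {f : Fin n → TropicalPolynomial n} {p : Fin n → ℝ}

/-- Each of the `n` codimensions is at least 1 and their sum is at most `n`, so all equal 1. One
difference of active exponents therefore already cuts out the direction space of each piece, and
these spaces meet only in zero. -/
theorem eq_zero_of_mem_nondegenerateSolutions (hp : p ∈ nondegenerateSolutions f)
    {w w' : ∀ i, (f i).support} (hw : ∀ i, w i ∈ (f i).activeSet p)
    (hw' : ∀ i, w' i ∈ (f i).activeSet p) (hne : ∀ i, w i ≠ w' i) {v : Fin n → ℝ}
    (hv : ∀ i, ((w i : Fin n → ℝ) - (w' i : Fin n → ℝ)) ⬝ᵥ v = 0) : v = 0 := by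
  let d : Fin n → Fin n → ℝ := fun i => (w i : Fin n → ℝ) - (w' i : Fin n → ℝ)
  have hd : ∀ i, d i ≠ 0 := fun i h => hne i (Subtype.ext (sub_eq_zero.1 h))
  let K : Fin n → Submodule ℝ (Fin n → ℝ) := fun i => LinearMap.ker (dotProductBilin ℝ ℝ (d i))
  have hK : ∀ i, Module.finrank ℝ (K i) + 1 = n := fun i => finrank_ker_dotProduct (hd i)
  have hle : ∀ i, vectorSpan ℝ ((f i).piece p) ≤ K i := fun i x hx =>
    (f i).sub_dotProduct_eq_zero_of_mem_vectorSpan hx (hw i) (hw' i)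
  have h1 : ∀ i, 1 ≤ affineCodim ((f i).piece p) := by
    intro i
    have := Submodule.finrank_mono (hle i)
    have := hK i
    unfold affineCodim
    omega
  have hsum : n ≤ ∑ i, affineCodim ((f i).piece p) := by
    simpa using Finset.sum_le_sum fun i (_ : i ∈ Finset.univ) => h1 i
  have hcap : affineCodim (⋂ i, (f i).piece p) ≤ n := Nat.sub_le _ _
  have hsum' : ∑ i : Fin n, 1 = ∑ i, affineCodim ((f i).piece p) := by
    have := hp.2
    simp only [Finset.sum_const, Finset.card_univ, Fintype.card_fin, smul_eq_mul, mul_one]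
    omega
  have heq : ∀ i, vectorSpan ℝ ((f i).piece p) = K i := by
    intro i
    have h2 := (Finset.sum_eq_sum_iff_of_le fun i _ => h1 i).1 hsum' i (Finset.mem_univ i)
    refine Submodule.eq_of_le_of_finrank_le (hle i) ?_
    have := hK i
    unfold affineCodim at h2
    omega
  have hmem : v ∈ vectorSpan ℝ (⋂ i, (f i).piece p) := by
    refine TropicalPolynomial.mem_vectorSpan_iInter_piece f fun i u hu u' hu' => ?_
    refine (f i).sub_dotProduct_eq_zero_of_mem_vectorSpan (p := p) ?_ hu hu'
    rw [heq i]
    exact hv i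
  -- For `n = 0` the truncated equation `n - r = n` says nothing about `r`.
  rcases Nat.eq_zero_or_pos n with rfl | hn
  · exact Subsingleton.elim _ _
  have hz : Module.finrank ℝ (vectorSpan ℝ (⋂ i, (f i).piece p)) = 0 := by
    have := hp.2
    unfold affineCodim at this hsum hcap
    omega
  rw [Submodule.finrank_eq_zero] at hz
  rw [hz] at hmem
  exact (Submodule.mem_bot ℝ).1 hmem

theorem mem_nondegenerateSolutions_of_activeSet_eq_pair {w w' : ∀ i, (f i).support}
    (hne : ∀ i, w i ≠ w' i) (hact : ∀ i, (f i).activeSet p = {w i, w' i})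
    (hsep : ∀ v : Fin n → ℝ,
      (∀ i, ((w i : Fin n → ℝ) - (w' i : Fin n → ℝ)) ⬝ᵥ v = 0) → v = 0) :
    p ∈ nondegenerateSolutions f := by
  have hw : ∀ i, w i ∈ (f i).activeSet p := fun i => by simp [hact i]
  have hw' : ∀ i, w' i ∈ (f i).activeSet p := fun i => by simp [hact i]
  refine ⟨fun i => ⟨w i, hw i, w' i, hw' i, hne i⟩, ?_⟩
  have h1 : ∀ i, affineCodim ((f i).piece p) = 1 := by
    intro i
    have heq : vectorSpan ℝ ((f i).piece p) =
        LinearMap.ker (dotProductBilin ℝ ℝ ((w i : Fin n → ℝ) - (w' i : Fin n → ℝ))) := by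
      refine le_antisymm (fun x hx =>
        (f i).sub_dotProduct_eq_zero_of_mem_vectorSpan hx (hw i) (hw' i)) fun x hx => ?_
      have hx' : ((w i : Fin n → ℝ) - (w' i : Fin n → ℝ)) ⬝ᵥ x = 0 := hx
      rw [sub_dotProduct, sub_eq_zero] at hx'
      refine (f i).mem_vectorSpan_piece fun u hu u' hu' => ?_
      rw [hact i] at hu hu'
      rw [sub_dotProduct, sub_eq_zero]
      rcases hu with rfl | rfl <;> rcases hu' with rfl | rfl <;> simp [hx']
    have := finrank_ker_dotProduct (sub_ne_zero.2 fun h => hne i (Subtype.ext h))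
    unfold affineCodim
    rw [heq]
    omega
  have h2 : vectorSpan ℝ (⋂ i, (f i).piece p) = ⊥ := by
    rw [eq_bot_iff]
    intro x hx
    refine (Submodule.mem_bot ℝ).2 (hsep x fun i => ?_)
    exact (f i).sub_dotProduct_eq_zero_of_mem_vectorSpan
      (vectorSpan_mono ℝ (Set.iInter_subset (fun i => (f i).piece p) i) hx) (hw i) (hw' i)
  rw [Finset.sum_congr rfl fun i _ => h1 i, affineCodim, h2]
  simp

/-- A functional that is negative on the dual basis of `d` up to the signs of the coordinates
of `x` is negative at `x`. -/
theorem lt_of_forall_dotProduct_nonpos {d g : Fin n → Fin n → ℝ} {φ : Module.Dual ℝ (Fin n → ℝ)}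
    (hg : ∀ x, x = ∑ i, (d i ⬝ᵥ x) • g i) {x : Fin n → ℝ} (hx : x ≠ 0)
    (hneg : ∀ i, (d i ⬝ᵥ x) * φ (g i) ≤ 0) (hφ : ∀ i, φ (g i) ≠ 0) : φ x < 0 := by
  have h1 : φ x = ∑ i, (d i ⬝ᵥ x) * φ (g i) := by
    conv_lhs => rw [hg x]
    simp
  rw [h1]
  refine Finset.sum_neg' (fun i _ => hneg i) ?_
  by_contra! hall
  refine hx ?_
  rw [hg x]
  refine Finset.sum_eq_zero fun i hi => ?_
  have h2 := le_antisymm (hneg i) (hall i hi)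
  rw [(mul_eq_zero.1 h2).resolve_right (hφ i), zero_smul]

theorem card_le_of_forall_mem_nondegenerateSolutions (S : Finset (Fin n → ℝ))
    (hS : ∀ p ∈ S, p ∈ nondegenerateSolutions f) :
    S.card ≤ ∏ i, ((f i).support.card - 1) := by
  classical
  have hex : ∀ p : S, ∃ w w' : ∀ i, (f i).support, ∃ g : Fin n → Fin n → ℝ,
      (∀ i, w i ∈ (f i).activeSet p) ∧ (∀ i, w' i ∈ (f i).activeSet p) ∧ (∀ i, w i ≠ w' i) ∧
      (∀ i, g i ≠ 0) ∧
      ∀ x, x = ∑ i, (((w i : Fin n → ℝ) - (w' i : Fin n → ℝ)) ⬝ᵥ x) • g i := by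
    intro p
    choose w hw w' hw' hne using (hS p p.2).1
    obtain ⟨g, hg0, hg⟩ := exists_dual_basis
      (fun i => (w i : Fin n → ℝ) - (w' i : Fin n → ℝ)) fun v hv =>
        eq_zero_of_mem_nondegenerateSolutions (hS p p.2) hw hw' hne hv
    exact ⟨w, w', g, hw, hw', hne, hg0, hg⟩
  choose w w' g hw hw' hne hg0 hg using hex
  -- One generic functional serves all solutions in `S` at once, so its values order them.
  obtain ⟨φ, hφ⟩ := Module.exists_dual_forall_apply_ne_zero (K := ℝ)
    (fun q : S × Fin n => g q.1 q.2) fun q => hg0 q.1 q.2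
  -- Orientation: moving along the dual vector in the direction that favours `a` over `b` decreases
  -- `φ`.
  let a : S → ∀ i, (f i).support := fun p i => if φ (g p i) < 0 then w p i else w' p i
  let b : S → ∀ i, (f i).support := fun p i => if φ (g p i) < 0 then w' p i else w p i
  have hab : ∀ (p : S) i, a p i ≠ b p i := by
    intro p i
    by_cases h : φ (g p i) < 0
    · simpa [a, b, h] using hne p i
    · simpa [a, b, h] using (hne p i).symm
  have hact : ∀ (p : S) i, a p i ∈ (f i).activeSet p ∧ b p i ∈ (f i).activeSet p := by
    intro p i
    by_cases h : φ (g p i) < 0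
    · simpa [a, b, h] using ⟨hw p i, hw' p i⟩
    · simpa [a, b, h] using ⟨hw' p i, hw p i⟩
  have key := card_le_prod_card_sub_one a b hab (fun p => φ p) ?_
  · simpa using key
  intro p q hpq
  refine or_iff_not_imp_left.2 fun hqp => ?_
  have hx : (q : Fin n → ℝ) - p ≠ 0 := sub_ne_zero.2 fun h => hqp (Subtype.ext h)
  have hneg : ∀ i, (((w p i : Fin n → ℝ) - (w' p i : Fin n → ℝ)) ⬝ᵥ ((q : Fin n → ℝ) - p)) *
      φ (g p i) ≤ 0 := by
    intro i
    have haq : a p i ∈ (f i).activeSet q := by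
      rcases hpq i with h | h <;> rw [h]
      · exact (hact q i).1
      · exact (hact q i).2
    have h1 := (f i).mem_activeSet_iff.1 haq (b p i)
    have h2 : (f i).monomial (a p i) p = (f i).eval p := (hact p i).1
    have h3 : (f i).monomial (b p i) p = (f i).eval p := (hact p i).2
    have h4 := (f i).monomial_sub_monomial (a p i) q p
    have h5 := (f i).monomial_sub_monomial (b p i) q p
    rw [sub_dotProduct]
    by_cases h : φ (g p i) < 0
    · simp only [a, b, h, if_true] at h1 h2 h3 h4 h5
      exact mul_nonpos_of_nonneg_of_nonpos (by linarith) h.le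
    · simp only [a, b, h, if_false] at h1 h2 h3 h4 h5
      exact mul_nonpos_of_nonpos_of_nonneg (by linarith) (not_lt.1 h)
  have := lt_of_forall_dotProduct_nonpos (hg p) hx hneg fun i => hφ (p, i)
  rw [map_sub] at this
  linarith

theorem encard_nondegenerateSolutions_le (f : Fin n → TropicalPolynomial n) :
    (nondegenerateSolutions f).encard ≤ ((∏ i, ((f i).support.card - 1) : ℕ) : ℕ∞) := by
  by_contra! hlt
  -- A finite subset with one element too many also rules out an infinite solution set.
  obtain ⟨t, ht, hcard⟩ := Set.exists_subset_encard_eq (Order.add_one_le_of_lt hlt)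
  have hfin : t.Finite := Set.finite_of_encard_eq_coe (k := ∏ i, ((f i).support.card - 1) + 1)
    (by rw [hcard]; push_cast; rfl)
  have h1 := card_le_of_forall_mem_nondegenerateSolutions hfin.toFinset
    fun p hp => ht (hfin.mem_toFinset.1 hp)
  rw [hfin.encard_eq_coe_toFinset_card] at hcard
  norm_cast at hcard
  omega

end NondegenerateSolutions

/-! ### Sharpness: a grid of solutions and its perturbations. -/

/-- A tropical polynomial with an enumerated support and prescribed coefficients. -/
theorem exists_tropicalPolynomial_of_injective {n k : ℕ} (hk : 1 ≤ k) {c : Fin k → Fin n → ℝ}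
    (hc : Function.Injective c) (a : Fin k → ℝ) :
    ∃ (f : TropicalPolynomial n) (e : Fin k ≃ f.support),
      (∀ j, (e j : Fin n → ℝ) = c j) ∧ ∀ j x, f.monomial (e j) x = a j + c j ⬝ᵥ x := by
  classical
  let s : Finset (Fin n → ℝ) := Finset.univ.image c
  let e : Fin k ≃ s := Equiv.ofBijective (fun j => ⟨c j, Finset.mem_image_of_mem c (by simp)⟩)
    ⟨fun i j h => hc (congrArg Subtype.val h), by
      rintro ⟨w, hw⟩
      obtain ⟨j, -, rfl⟩ := Finset.mem_image.1 hw
      exact ⟨j, rfl⟩⟩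
  refine ⟨⟨s, ⟨c ⟨0, hk⟩, Finset.mem_image_of_mem c (by simp)⟩, fun w => a (e.symm w)⟩, e,
    fun j => rfl, fun j x => ?_⟩
  show a (e.symm (e j)) + _ = _
  rw [Equiv.symm_apply_apply]
  rfl

/-- A solution at which exactly two monomials of each equation are active, with linearly
independent differences of exponents, persists under small perturbations of the exponents. -/
theorem eventually_exists_transverse_solution {n : ℕ} {k : Fin n → ℕ} (a : ∀ i, Fin (k i) → ℝ)
    (c₀ : (i : Fin n) → Fin (k i) → Fin n → ℝ) (u u' : ∀ i, Fin (k i)) (p₀ : Fin n → ℝ)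
    (heq : ∀ i, a i (u i) + c₀ i (u i) ⬝ᵥ p₀ = a i (u' i) + c₀ i (u' i) ⬝ᵥ p₀)
    (hlt : ∀ i j, j ≠ u i → j ≠ u' i →
      a i j + c₀ i j ⬝ᵥ p₀ < a i (u i) + c₀ i (u i) ⬝ᵥ p₀)
    (hdet : (Matrix.of fun i => c₀ i (u i) - c₀ i (u' i)).det ≠ 0) :
    ∀ᶠ c in nhds c₀, ∃ p : Fin n → ℝ,
      (∀ i, a i (u i) + c i (u i) ⬝ᵥ p = a i (u' i) + c i (u' i) ⬝ᵥ p) ∧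
      (∀ i j, j ≠ u i → j ≠ u' i → a i j + c i j ⬝ᵥ p < a i (u i) + c i (u i) ⬝ᵥ p) ∧
      ∀ v, (∀ i, (c i (u i) - c i (u' i)) ⬝ᵥ v = 0) → v = 0 := by
  let M : ((i : Fin n) → Fin (k i) → Fin n → ℝ) → Matrix (Fin n) (Fin n) ℝ :=
    fun c => Matrix.of fun i => c i (u i) - c i (u' i)
  let b : Fin n → ℝ := fun i => a i (u' i) - a i (u i)
  -- Cramer's formula, which makes the solution visibly continuous in the exponents where the
  -- determinant is nonzero.
  let p : ((i : Fin n) → Fin (k i) → Fin n → ℝ) → Fin n → ℝ :=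
    fun c => (M c).det⁻¹ • (M c).adjugate.mulVec b
  have hM : Continuous M := by
    refine continuous_matrix fun i j => ?_
    simp only [M, Matrix.of_apply, Pi.sub_apply]
    fun_prop
  have hp : ContinuousAt p c₀ :=
    (hM.matrix_det.continuousAt.inv₀ hdet).smul
      (hM.matrix_adjugate.matrix_mulVec continuous_const).continuousAt
  have hp₀ : p c₀ = p₀ := by
    have h1 : (M c₀).mulVec p₀ = b := by
      ext i
      have := heq i
      show (c₀ i (u i) - c₀ i (u' i)) ⬝ᵥ p₀ = a i (u' i) - a i (u i)
      rw [sub_dotProduct]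
      linarith
    show (M c₀).det⁻¹ • (M c₀).adjugate.mulVec b = p₀
    rw [← h1, Matrix.mulVec_mulVec, Matrix.adjugate_mul, Matrix.smul_mulVec, Matrix.one_mulVec,
      smul_smul, inv_mul_cancel₀ hdet, one_smul]
  have hev1 : ∀ᶠ c in nhds c₀, (M c).det ≠ 0 := hM.matrix_det.continuousAt.eventually_ne hdet
  have hval : ∀ i j, ContinuousAt (fun c : (i : Fin n) → Fin (k i) → Fin n → ℝ =>
      a i j + c i j ⬝ᵥ p c) c₀ := by
    intro i j
    simp only [dotProduct]
    refine continuousAt_const.add (tendsto_finsetSum _ fun l _ => ?_)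
    exact ContinuousAt.mul (f := fun c : (i : Fin n) → Fin (k i) → Fin n → ℝ => c i j l)
      ((continuous_apply l).comp ((continuous_apply j).comp (continuous_apply i))).continuousAt
      ((continuousAt_apply l _).comp hp)
  have hev2 : ∀ᶠ c in nhds c₀, ∀ i j, j ≠ u i → j ≠ u' i →
      a i j + c i j ⬝ᵥ p c < a i (u i) + c i (u i) ⬝ᵥ p c := by
    refine Filter.eventually_all.2 fun i => Filter.eventually_all.2 fun j => ?_
    by_cases hj : j ≠ u i ∧ j ≠ u' i
    · refine ((hval i j).eventually_lt (hval i (u i)) ?_).mono fun c h _ _ => h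
      rw [hp₀]
      exact hlt i j hj.1 hj.2
    · exact Filter.Eventually.of_forall fun c h h' => absurd ⟨h, h'⟩ hj
  filter_upwards [hev1, hev2] with c hc1 hc2
  refine ⟨p c, fun i => ?_, hc2, fun v hv => ?_⟩
  · have h1 : (M c).mulVec (p c) = b := by
      show (M c).mulVec ((M c).det⁻¹ • (M c).adjugate.mulVec b) = b
      rw [Matrix.mulVec_smul, Matrix.mulVec_mulVec, Matrix.mul_adjugate, Matrix.smul_mulVec,
        Matrix.one_mulVec, smul_smul, inv_mul_cancel₀ hc1, one_smul]
    have h2 : (c i (u i) - c i (u' i)) ⬝ᵥ p c = a i (u' i) - a i (u i) := congrFun h1 i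
    rw [sub_dotProduct] at h2
    linarith
  · by_contra hne
    exact hc1 (Matrix.exists_mulVec_eq_zero_iff.1 ⟨v, hne, funext hv⟩)

/-- The points `j • eᵢ` with the coefficients `-j²` give a system with the maximal number of
transverse solutions, and so do all nearby configurations. -/
theorem eventually_forall_exists_transverse_solution {n : ℕ} (k : Fin n → ℕ) :
    ∀ᶠ c in nhds (fun i j => Pi.single i (j : ℝ) : (i : Fin n) → Fin (k i) → Fin n → ℝ),
      ∀ m : (i : Fin n) → Fin (k i - 1), ∃ u u' : ∀ i, Fin (k i), ∃ p : Fin n → ℝ,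
      (∀ i, (u i : ℕ) = m i ∧ (u' i : ℕ) = m i + 1) ∧
      (∀ i, -((u i : ℕ) : ℝ) ^ 2 + c i (u i) ⬝ᵥ p = -((u' i : ℕ) : ℝ) ^ 2 + c i (u' i) ⬝ᵥ p) ∧
      (∀ i j, j ≠ u i → j ≠ u' i →
        -((j : ℕ) : ℝ) ^ 2 + c i j ⬝ᵥ p < -((u i : ℕ) : ℝ) ^ 2 + c i (u i) ⬝ᵥ p) ∧
      ∀ v, (∀ i, (c i (u i) - c i (u' i)) ⬝ᵥ v = 0) → v = 0 := by
  refine Filter.eventually_all.2 fun m => ?_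
  let u : ∀ i, Fin (k i) := fun i => ⟨m i, by have := (m i).2; omega⟩
  let u' : ∀ i, Fin (k i) := fun i => ⟨m i + 1, by have := (m i).2; omega⟩
  -- The monomials `-m² + m x` and `-(m+1)² + (m+1) x` agree at `x = 2m + 1`.
  refine (eventually_exists_transverse_solution (fun i j => -((j : ℕ) : ℝ) ^ 2) _ u u'
    (fun i => 2 * (m i : ℕ) + 1) ?_ ?_ ?_).mono fun c ⟨p, h⟩ => ⟨u, u', p, fun i => ⟨rfl, rfl⟩, h⟩
  · intro i
    simp only [u, u', single_dotProduct]
    push_cast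
    ring
  · intro i j hj hj'
    simp only [u, single_dotProduct]
    have h1 : (j : ℕ) ≠ m i := fun h => hj (Fin.ext h)
    have h2 : (j : ℕ) ≠ m i + 1 := fun h => hj' (Fin.ext h)
    -- The gap between the two values is `(j - m)(j - m - 1)`, positive for integers `j ≠ m, m + 1`.
    rcases Nat.lt_or_ge (j : ℕ) (m i) with h3 | h3
    · have h4 : ((j : ℕ) : ℝ) + 1 ≤ ((m i : ℕ) : ℝ) := by exact_mod_cast h3
      nlinarith
    · have h4 : ((m i : ℕ) : ℝ) + 2 ≤ ((j : ℕ) : ℝ) := by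
        have : (m i : ℕ) + 2 ≤ j := by omega
        exact_mod_cast this
      nlinarith
  · have : (Matrix.of fun i => (Pi.single i ((u i : ℕ) : ℝ) : Fin n → ℝ) -
        Pi.single i ((u' i : ℕ) : ℝ)) = -(1 : Matrix (Fin n) (Fin n) ℝ) := by
      ext i j
      rcases eq_or_ne j i with rfl | hij
      · simp [u, u']
      · simp [u, u', hij, hij.symm]
    rw [this, Matrix.det_neg]
    simp

theorem encard_nondegenerateSolutions_ge {n : ℕ} {k : Fin n → ℕ} {a : ∀ i, Fin (k i) → ℝ}
    {c : (i : Fin n) → Fin (k i) → Fin n → ℝ} {f : Fin n → TropicalPolynomial n}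
    (e : ∀ i, Fin (k i) ≃ (f i).support) (he : ∀ i j, (e i j : Fin n → ℝ) = c i j)
    (hmon : ∀ i j x, (f i).monomial (e i j) x = a i j + c i j ⬝ᵥ x)
    (h : ∀ m : (i : Fin n) → Fin (k i - 1), ∃ u u' : ∀ i, Fin (k i), ∃ p : Fin n → ℝ,
      (∀ i, (u i : ℕ) = m i ∧ (u' i : ℕ) = m i + 1) ∧
      (∀ i, a i (u i) + c i (u i) ⬝ᵥ p = a i (u' i) + c i (u' i) ⬝ᵥ p) ∧
      (∀ i j, j ≠ u i → j ≠ u' i → a i j + c i j ⬝ᵥ p < a i (u i) + c i (u i) ⬝ᵥ p) ∧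
      ∀ v, (∀ i, (c i (u i) - c i (u' i)) ⬝ᵥ v = 0) → v = 0) :
    ((∏ i, (k i - 1) : ℕ) : ℕ∞) ≤ (nondegenerateSolutions f).encard := by
  choose u u' p hu heq hlt hsep using h
  have hle : ∀ m i j, a i j + c i j ⬝ᵥ p m ≤ a i (u m i) + c i (u m i) ⬝ᵥ p m := by
    intro m i j
    by_cases h1 : j = u m i
    · rw [h1]
    by_cases h2 : j = u' m i
    · rw [h2, heq]
    exact (hlt m i j h1 h2).le
  have hact : ∀ m i, (f i).activeSet (p m) = {e i (u m i), e i (u' m i)} := by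
    intro m i
    ext w
    obtain ⟨j, rfl⟩ := (e i).surjective w
    rw [TropicalPolynomial.mem_activeSet_iff, (e i).surjective.forall]
    simp only [hmon, Set.mem_insert_iff, Set.mem_singleton_iff, (e i).injective.eq_iff]
    constructor
    · intro hj
      by_contra! hne
      exact absurd (hj (u m i)) (not_le.2 (hlt m i j hne.1 hne.2))
    · rintro (rfl | rfl) j'
      · exact hle m i j'
      · rw [← heq]
        exact hle m i j'
  -- The active pair `{m i, m i + 1}` at `p m` determines `m i`.
  have hinj : Function.Injective p := by
    intro m m' hmm
    funext i
    have h1 := hact m i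
    rw [hmm, hact m' i] at h1
    have h2 : e i (u m i) ∈ ({e i (u m' i), e i (u' m' i)} : Set _) := by rw [h1]; simp
    have h3 : e i (u m' i) ∈ ({e i (u m i), e i (u' m i)} : Set _) := by rw [← h1]; simp
    simp only [Set.mem_insert_iff, Set.mem_singleton_iff, (e i).injective.eq_iff,
      Fin.ext_iff] at h2 h3
    have h4 := hu m i
    have h5 := hu m' i
    exact Fin.ext (by omega)
  have hsub : Set.range p ⊆ nondegenerateSolutions f := by
    rintro _ ⟨m, rfl⟩
    refine mem_nondegenerateSolutions_of_activeSet_eq_pair (w := fun i => e i (u m i))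
      (w' := fun i => e i (u' m i)) (fun i h1 => ?_) (hact m) fun v hv => hsep m v fun i => ?_
    · have h2 := Fin.ext_iff.1 ((e i).injective h1)
      have := hu m i
      omega
    · simpa only [he] using hv i
  refine le_trans ?_ (Set.encard_le_encard hsub)
  rw [← Set.image_univ, hinj.encard_image, Set.encard_univ]
  simp

/-- Near a configuration all sums of which are distinct, the configurations have the same
property. -/
theorem eventually_injective_sum {ι E : Type*} [Fintype ι] [AddCommMonoid E] [TopologicalSpace E]
    [ContinuousAdd E] [T2Space E] {κ : ι → Type*} [∀ i, Finite (κ i)] {c₀ : ∀ i, κ i → E}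
    (h : Function.Injective fun j : ∀ i, κ i => ∑ i, c₀ i (j i)) :
    ∀ᶠ c in nhds c₀, Function.Injective fun j : ∀ i, κ i => ∑ i, c i (j i) := by
  have hcont : ∀ j : ∀ i, κ i, Continuous fun c : ∀ i, κ i → E => ∑ i, c i (j i) :=
    fun j => by fun_prop
  have : ∀ᶠ c in nhds c₀, ∀ j j' : ∀ i, κ i, j ≠ j' → ∑ i, c i (j i) ≠ ∑ i, c i (j' i) := by
    refine Filter.eventually_all.2 fun j => Filter.eventually_all.2 fun j' => ?_
    by_cases hj : j = j'
    · exact Filter.Eventually.of_forall fun c hne => absurd hj hne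
    · exact ((isOpen_ne_fun (hcont j) (hcont j')).eventually_mem (h.ne hj)).mono fun c hc _ => hc
  exact this.mono fun c hc j j' hjj => by_contra fun hne => hc j j' hne hjj

/-- Vary one index and keep the others fixed. This yields `|Wᵢ| = kᵢ` from the distinctness of the
sums. -/
theorem injective_of_injective_sum {ι E : Type*} [Fintype ι] [AddCommMonoid E]
    {κ : ι → Type*} [∀ i, Nonempty (κ i)] {c : ∀ i, κ i → E}
    (h : Function.Injective fun j : ∀ i, κ i => ∑ i, c i (j i)) (i : ι) :
    Function.Injective (c i) := by
  classical
  intro x y hxy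
  let o : ∀ i, κ i := fun i => Classical.arbitrary _
  have : Function.update o i x = Function.update o i y := by
    refine h (Finset.sum_congr rfl fun l _ => ?_)
    rcases eq_or_ne l i with rfl | hl
    · simpa using hxy
    · simp [hl]
  simpa using congrFun this i

theorem theoremT (n : ℕ) :
    (∀ (W : Fin n → Finset (Fin n → ℝ)) (f : Fin n → TropicalPolynomial n),
      (∀ i, (f i).support = W i) →
        (nondegenerateSolutions f).encard ≤ ((∏ i, ((W i).card - 1) : ℕ) : ℕ∞)) ∧
    (∀ k : Fin n → ℕ, (∀ i, 1 ≤ k i) →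
      ∃ U : Set ((i : Fin n) → Fin (k i) → (Fin n → ℝ)), IsOpen U ∧ U.Nonempty ∧
        ∀ c ∈ U,
          (∀ i, Function.Injective (c i)) ∧
          Function.Injective (fun j : (i : Fin n) → Fin (k i) => ∑ i, c i (j i)) ∧
          ∃ f : Fin n → TropicalPolynomial n,
            (∀ i, ((f i).support : Set (Fin n → ℝ)) = Set.range (c i)) ∧
            (nondegenerateSolutions f).encard = ((∏ i, (k i - 1) : ℕ) : ℕ∞)) := by
  constructor
  · intro W f hf
    simpa only [hf] using encard_nondegenerateSolutions_le f
  · intro k hk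
    have hne : ∀ i, Nonempty (Fin (k i)) := fun i => ⟨⟨0, hk i⟩⟩
    have hinj : Function.Injective fun j : (i : Fin n) → Fin (k i) =>
        ∑ i, (Pi.single i ((j i : ℕ) : ℝ) : Fin n → ℝ) := by
      intro j j' h
      simp only [Finset.univ_sum_single] at h
      funext i
      have := congrFun h i
      exact Fin.ext (by exact_mod_cast this)
    -- Both requirements are open conditions at the grid configuration, so one neighbourhood serves
    -- both.
    obtain ⟨U, hU, hopen, hmem⟩ := eventually_nhds_iff.1
      ((eventually_forall_exists_transverse_solution k).and (eventually_injective_sum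
        (c₀ := fun i (j : Fin (k i)) => (Pi.single i ((j : ℕ) : ℝ) : Fin n → ℝ)) hinj))
    refine ⟨U, hopen, ⟨_, hmem⟩, fun c hc => ?_⟩
    obtain ⟨hsol, hsum⟩ := hU c hc
    have hci := injective_of_injective_sum hsum
    refine ⟨hci, hsum, ?_⟩
    choose f e he hmon using fun i => exists_tropicalPolynomial_of_injective (hk i) (hci i)
      fun j => -((j : ℕ) : ℝ) ^ 2
    have hcard : ∀ i, (f i).support.card = k i := fun i => by
      simpa using (Fintype.card_congr (e i)).symm
    refine ⟨f, fun i => ?_, le_antisymm ?_ (encard_nondegenerateSolutions_ge e he hmon hsol)⟩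
    · ext w
      constructor
      · intro hw
        obtain ⟨j, hj⟩ := (e i).surjective ⟨w, hw⟩
        exact ⟨j, by rw [← he, hj]⟩
      · rintro ⟨j, rfl⟩
        rw [← he]
        exact (e i j).2
    · simpa only [hcard] using encard_nondegenerateSolutions_le f
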